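/- Let $E$ be a finite-dimensional Euclidean space (for instance $\mathbb{R}^n$ or $\mathbb{R}^{m\times n}$) and let $\mathcal{M}\subset E$ be a $p$-dimensional $\mathcal{C}^2$-submanifold. The tangent space $T_x\mathcal{M}$ is the set of velocities $c'(0)$ of $\mathcal{C}^2$ curves $c$ on $\mathcal{M}$ with $c(0)=x$, equipped with the inner product of $E$; $T\mathcal{M}=\{(x,\eta): x\in\mathcal{M},\ \eta\in T_x\mathcal{M}\}$; $\mathrm{dist}_{\mathcal{M}}(x,y)\in[0,\infty]$ is the infimum of the lengths of $\mathcal{C}^2$ curves $[0,1]\to\mathcal{M}$ from $x$ to $y$. The gradient $\operatorname{grad} f(x)\in T_x\mathcal{M}$ is defined by $(f\circ c)'(0)=\langle \operatorname{grad} f(x),c'(0)\rangle$, and the Hessian by $\operatorname{Hess} f(x)[\eta]=\mathrm{proj}_{T_x\mathcal{M}}\big(\tfrac{d}{dt}\operatorname{grad} f(c(t))|_{t=0}\big)$, for $\mathcal{C}^2$ curves $c$ on $\mathcal{M}$ with $c(0)=x$ (and $c'(0)=\eta$ for the Hessian). Let $R:T\mathcal{M}\to\mathcal{M}$ be a retraction,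 that is, a $\mathcal{C}^1$ map such that, writing $R_x=R(x,\cdot)$, $R_x(0)=x$ and $DR_x(0)$ is the identity of $T_x\mathcal{M}$ for all $x\in\mathcal{M}$. **Theorem (soundness of the Riemannian line search).** Let $x^\star\in\mathcal{M}$. There is $\rho>0$, depending only on $\mathcal{M}$, $R$ and $x^\star$, such that the following holds. Let $f:\mathcal{M}\to\mathbb{R}$ be twice differentiable (that is, $f$ and $\operatorname{grad} f$ are differentiable on $\mathcal{M}$), let $x^\star$ be a strong local minimizer of $f$ (that is, a local minimizer at which $\operatorname{Hess} f(x^\star)$ is positive definite), and let $0<m_1<1/2$. For every family of pairs $(x,\eta)\in T\mathcal{M}$ with $x\to x^\star$ (along any sequence, or more generally any filter), with $\|\eta\|\le\rho$, and with the superlinear improvement $$\mathrm{dist}_{\mathcal{M}}(R_x(\eta),x^\star)=o\big(\mathrm{dist}_{\mathcal{M}}(x,x^\star)\big)\quad\text{as } x\to x^\star,$$ the unit stepsize $\alpha=1$ satisfies the Armijo condition $$f(R_x(\alpha\eta))\le f(x)+m_1\,\alpha\,\langle\operatorname{grad} f(x),\eta\rangle$$ for all pairs $(x,\eta)$ of the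 family with $x$ close enough to $x^\star$ (that is, eventually along the sequence or filter). -/

import Mathlib

open Set Filter Topology MeasureTheory
open scoped ENNReal NNReal

/-! Submanifolds of a Euclidean space `E` (such as `ℝⁿ` or `ℝᵐˣⁿ`), with the metric induced by the
inner product of `E`. Subsets of `E` are used for manifolds; a function or a retraction on `M` is
given by a map on the ambient space of which only the values on `M` (on the tangent bundle of `M`)
are ever used. -/

namespace RiemLineSearch

section Basic

variable {E : Type*} [NormedAddCommGroup E] [InnerProductSpace ℝ E]

/-- `M` is a `p`-dimensional `C²`-submanifold around `x`: there is a `C²` parametrization `φ` of a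
neighbourhood of `x` in `M` by a neighbourhood of `0 ∈ ℝᵖ`, with a `C²` local inverse `ψ` and an
injective derivative at `0`. -/
def IsC2SubmanifoldAt (p : ℕ) (M : Set E) (x : E) : Prop :=
  ∃ (φ : EuclideanSpace ℝ (Fin p) → E) (ψ : E → EuclideanSpace ℝ (Fin p))
    (U : Set (EuclideanSpace ℝ (Fin p))) (V : Set E),
    IsOpen U ∧ (0 : EuclideanSpace ℝ (Fin p)) ∈ U ∧ IsOpen V ∧ x ∈ V ∧
    ContDiffOn ℝ 2 φ U ∧ ContDiffOn ℝ 2 ψ V ∧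
    φ 0 = x ∧ φ '' U = M ∩ V ∧ (∀ u ∈ U, ψ (φ u) = u) ∧
    Function.Injective (fderiv ℝ φ 0)

/-- `M` is a `p`-dimensional `C²`-submanifold of `E`. -/
def IsC2Submanifold (p : ℕ) (M : Set E) : Prop :=
  ∀ x ∈ M, IsC2SubmanifoldAt p M x

/-- `c` is a smooth (that is, `C²`) curve on `M`, defined near time `0`, with `c 0 = x`. -/
structure IsSmoothCurveAt (M : Set E) (x : E) (c : ℝ → E) : Prop where
  contDiffAt : ContDiffAt ℝ 2 c 0
  eventually_mem : ∀ᶠ t in 𝓝 (0 : ℝ), c t ∈ M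
  map_zero : c 0 = x

/-- The set of the velocities at time `0` of all smooth curves on `M` passing by `x` at `0`. -/
def velocities (M : Set E) (x : E) : Set E :=
  {v | ∃ c : ℝ → E, IsSmoothCurveAt M x c ∧ deriv c 0 = v}

/-- The tangent space of `M` at `x`. On a submanifold the set of velocities is already a linear
subspace (see `mem_tangentAt_iff`), so that taking the span adds nothing. -/
def tangentAt (M : Set E) (x : E) : Submodule ℝ E :=
  Submodule.span ℝ (velocities M x)

theorem mem_tangentAt_iff {p : ℕ} {M : Set E} {x : E} (hM : IsC2SubmanifoldAt p M x) {v : E} :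
    v ∈ tangentAt M x ↔ ∃ c : ℝ → E, IsSmoothCurveAt M x c ∧ deriv c 0 = v := by
  obtain ⟨φ, ψ, U, V, hU, h0U, hV, hxV, hφ, hψ, hφ0, hφU, hψφ, -⟩ := hM
  have hφd : ContDiffAt ℝ 2 φ 0 := hφ.contDiffAt (hU.mem_nhds h0U)
  have hrange : velocities M x = (((fderiv ℝ φ 0).toLinearMap.range : Submodule ℝ E) : Set E) := by
    ext v
    constructor
    · rintro ⟨c, hc, rfl⟩
      have hcd : DifferentiableAt ℝ c 0 := hc.contDiffAt.differentiableAt (by norm_num)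
      have hψd : DifferentiableAt ℝ ψ (c 0) := by
        rw [hc.map_zero]
        exact (hψ.contDiffAt (hV.mem_nhds hxV)).differentiableAt (by norm_num)
      have h1 : DifferentiableAt ℝ (ψ ∘ c) 0 := hψd.comp 0 hcd
      have h2 : (ψ ∘ c) 0 = 0 := by
        simp only [Function.comp_apply, hc.map_zero, ← hφ0, hψφ 0 h0U]
      have h3 : HasDerivAt (φ ∘ (ψ ∘ c)) (fderiv ℝ φ 0 (deriv (ψ ∘ c) 0)) 0 := by
        have h4 : HasFDerivAt φ (fderiv ℝ φ 0) ((ψ ∘ c) 0) := by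
          rw [h2]
          exact (hφd.differentiableAt (by norm_num)).hasFDerivAt
        exact h4.comp_hasDerivAt 0 h1.hasDerivAt
      have h5 : c =ᶠ[𝓝 0] φ ∘ (ψ ∘ c) := by
        have hcV : ∀ᶠ t in 𝓝 (0 : ℝ), c t ∈ V :=
          hcd.continuousAt.eventually_mem (hV.mem_nhds (by rw [hc.map_zero]; exact hxV))
        filter_upwards [hc.eventually_mem, hcV] with t ht1 ht2
        obtain ⟨u, hu, hut⟩ : c t ∈ φ '' U := hφU ▸ ⟨ht1, ht2⟩
        simp only [Function.comp_apply, ← hut, hψφ u hu]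
      rw [h5.deriv_eq, h3.deriv]
      exact ⟨_, rfl⟩
    · rintro ⟨w, rfl⟩
      have hl : ContDiffAt ℝ 2 (fun t : ℝ => t • w) 0 := by fun_prop
      have hld : HasDerivAt (fun t : ℝ => t • w) w 0 := by
        simpa using (hasDerivAt_id (0 : ℝ)).smul_const w
      have hφd' : ContDiffAt ℝ 2 φ ((0 : ℝ) • w) := by rwa [zero_smul]
      refine ⟨φ ∘ fun t : ℝ => t • w, ⟨hφd'.comp (0 : ℝ) hl, ?_, by simp [hφ0]⟩, ?_⟩
      · have : ∀ᶠ t in 𝓝 (0 : ℝ), t • w ∈ U :=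
          hld.continuousAt.eventually_mem (hU.mem_nhds (by simpa using h0U))
        filter_upwards [this] with t ht
        exact (hφU ▸ mem_image_of_mem φ ht : φ (t • w) ∈ M ∩ V).1
      · have h4 : HasFDerivAt φ (fderiv ℝ φ 0) ((0 : ℝ) • w) := by
          rw [zero_smul]
          exact (hφd.differentiableAt (by norm_num)).hasFDerivAt
        exact (h4.comp_hasDerivAt (0 : ℝ) hld).deriv
  change v ∈ Submodule.span ℝ (velocities M x) ↔ v ∈ velocities M x
  rw [hrange, Submodule.span_eq]
  rfl

/-- The tangent bundle of `M`, as the set of the pairs `(x, η)` with `x ∈ M` and `η` tangent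
to `M` at `x`. -/
def tangentBundle (M : Set E) : Set (E × E) :=
  {q | q.1 ∈ M ∧ q.2 ∈ tangentAt M q.1}

/-- The Riemannian distance: the infimum of the lengths of the smooth curves `[0, 1] → M` from `x`
to `y` (it is `∞` if there is no such curve). -/
noncomputable def riemDist (M : Set E) (x y : E) : ℝ≥0∞ :=
  ⨅ (c : ℝ → E) (_ : ContDiffOn ℝ 2 c (Icc 0 1) ∧ MapsTo c (Icc 0 1) M ∧ c 0 = x ∧ c 1 = y),
    ∫⁻ t in Icc (0 : ℝ) 1, ‖derivWithin c (Icc 0 1) t‖ₑ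

/-- `R` is a retraction on `M`: a smooth map from the tangent bundle of `M` to `M` with `R_x 0 = x`
and whose differential `D R_x(0)` is the identity of the tangent space at `x`. The tangent bundle
of a `C²`-submanifold is a `C¹`-submanifold of `E × E`; smoothness is accordingly understood
as `C¹`. -/
structure IsRetraction (M : Set E) (R : E → E → E) : Prop where
  contDiffOn : ContDiffOn ℝ 1 (fun q : E × E => R q.1 q.2) (tangentBundle M)
  mem : ∀ x ∈ M, ∀ v ∈ tangentAt M x, R x v ∈ M
  map_zero : ∀ x ∈ M, R x 0 = x
  hasFDerivWithinAt_zero : ∀ x ∈ M,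
    HasFDerivWithinAt (R x) (ContinuousLinearMap.id ℝ E) (tangentAt M x : Set E) 0

/-- `g` is a Riemannian gradient of `f` at `x`: a tangent vector that represents the Riemannian
differential `η = c'(0) ↦ (f ∘ c)'(0)`. -/
def IsRiemGradAt (M : Set E) (f : E → ℝ) (x g : E) : Prop :=
  g ∈ tangentAt M x ∧
    ∀ c : ℝ → E, IsSmoothCurveAt M x c → HasDerivAt (f ∘ c) (inner ℝ g (deriv c 0)) 0

theorem IsRiemGradAt.unique {M : Set E} {f : E → ℝ} {x g g' : E}
    (h : IsRiemGradAt M f x g) (h' : IsRiemGradAt M f x g') : g = g' := by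
  have key : ∀ v ∈ tangentAt M x, inner ℝ (g - g') v = 0 := by
    intro v hv
    induction hv using Submodule.span_induction with
    | mem v hv =>
      obtain ⟨c, hc, rfl⟩ := hv
      rw [inner_sub_left, (h.2 c hc).unique (h'.2 c hc), sub_self]
    | zero => simp
    | add v w _ _ hv hw => rw [inner_add_right, hv, hw, add_zero]
    | smul a v _ hv => rw [inner_smul_right, hv, mul_zero]
  have h0 := key _ (Submodule.sub_mem _ h.1 h'.1)
  exact sub_eq_zero.1 (inner_self_eq_zero.1 h0)

open Classical in
/-- The Riemannian gradient of `f` at `x` (`0` if there is none). -/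
noncomputable def riemGrad (M : Set E) (f : E → ℝ) (x : E) : E :=
  if h : ∃ g, IsRiemGradAt M f x g then h.choose else 0

/-- `f` is twice differentiable on the submanifold `M`: it is differentiable at all points of `M`,
and so is its Riemannian gradient. -/
def TwiceDifferentiableOn (M : Set E) (f : E → ℝ) : Prop :=
  DifferentiableOn ℝ f M ∧ DifferentiableOn ℝ (riemGrad M f) M

/-- The Armijo condition with constant `m₁` for the stepsize `α`, the point `x`
and the direction `η`. -/
def Armijo (M : Set E) (R : E → E → E) (f : E → ℝ) (m₁ α : ℝ) (x η : E) : Prop :=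
  f (R x (α • η)) ≤ f x + m₁ * α * inner ℝ (riemGrad M f x) η

/-- Along the filter `l`, the directions `η i` bring a superlinear improvement from the points `x i`
towards `y`: `dist (R_x η, y) = o (dist (x, y))` for the Riemannian distance of `M`. -/
def SuperlinearImprovement {ι : Type*} (M : Set E) (R : E → E → E) (y : E) (l : Filter ι)
    (x η : ι → E) : Prop :=
  ∀ ε : ℝ≥0, 0 < ε → ∀ᶠ i in l, riemDist M (R (x i) (η i)) y ≤ ε * riemDist M (x i) y

end Basic

section Hessian

variable {E : Type*} [NormedAddCommGroup E] [InnerProductSpace ℝ E] [FiniteDimensional ℝ E]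

/-- The covariant derivative at time `t` of a vector field `Z` along the curve `c` on `M`: the
orthogonal projection of `Z'(t)` onto the tangent space at `c t`. -/
noncomputable def covDeriv (M : Set E) (c Z : ℝ → E) (t : ℝ) : E :=
  (tangentAt M (c t)).starProjection (deriv Z t)

open Classical in
/-- The Riemannian Hessian of `f` at `x` along `η`: the covariant derivative at `0` of the gradient
of `f` along a smooth curve `c` on `M` with `c 0 = x` and `c'(0) = η`. When the gradient is
differentiable, the choice of the curve does not matter (see `riemHess_eq`). -/
noncomputable def riemHess (M : Set E) (f : E → ℝ) (x η : E) : E :=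
  if h : ∃ c : ℝ → E, IsSmoothCurveAt M x c ∧ deriv c 0 = η then
    covDeriv M h.choose (riemGrad M f ∘ h.choose) 0
  else 0

theorem riemHess_eq {M : Set E} {f : E → ℝ} {x : E} {c : ℝ → E}
    (hf : DifferentiableWithinAt ℝ (riemGrad M f) M x) (hc : IsSmoothCurveAt M x c) :
    riemHess M f x (deriv c 0) = covDeriv M c (riemGrad M f ∘ c) 0 := by
  have key : ∀ b : ℝ → E, IsSmoothCurveAt M x b →
      deriv (riemGrad M f ∘ b) 0 = fderivWithin ℝ (riemGrad M f) M x (deriv b 0) := by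
    intro b hb
    have h1 : HasFDerivWithinAt (riemGrad M f) (fderivWithin ℝ (riemGrad M f) M x) M (b 0) := by
      rw [hb.map_zero]
      exact hf.hasFDerivWithinAt
    exact (h1.comp_hasDerivAt 0 (hb.contDiffAt.differentiableAt (by norm_num)).hasDerivAt
      hb.eventually_mem).deriv
  have h : ∃ b : ℝ → E, IsSmoothCurveAt M x b ∧ deriv b 0 = deriv c 0 := ⟨c, hc, rfl⟩
  rw [riemHess, dif_pos h, covDeriv, covDeriv, key _ h.choose_spec.1, key _ hc, h.choose_spec.2]
  congr 2
  rw [h.choose_spec.1.map_zero, hc.map_zero]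

/-- `x` is a strong local minimizer of `f` on `M`: a local minimizer at which the Riemannian Hessian
is positive definite. -/
def IsStrongLocalMin (M : Set E) (f : E → ℝ) (x : E) : Prop :=
  IsLocalMinOn f M x ∧ ∀ η ∈ tangentAt M x, η ≠ 0 → 0 < inner ℝ (riemHess M f x η) η

end Hessian

end RiemLineSearch

/-! Work in a chart `φ` with `φ 0 = x*`, and write `x = φ u`, `y = R_x(η)`, `B = Dφ(0)`, `A` for the
derivative of the gradient at `x*`. The quadratic form `q(u) = ⟨A B u, B u⟩` is the Hessian read in
the chart, hence `q(u) ≥ a ‖u‖²` with `a > 0`. As the gradient vanishes at `x*`, `grad f(x) = A B u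
+ o(u)` and `f(x) = f(x*) + q(u)/2 + o(‖u‖²)` (`taylor_two_comp_isLittleO`). Superlinear improvement
gives `y - x* = o(u)`, so that `f(y) - f(x*) = o(‖u‖²)`. The retraction satisfies `y = x + η + o(η)`
uniformly near `(x*, 0)` (`IsRetraction.norm_sub_sub_le`), which forces `η = -B u + o(u)` and `⟨grad
f(x), η⟩ = -q(u) + o(‖u‖²)`. Therefore `f(y) - f(x) - m₁ ⟨grad f(x), η⟩ = -(1/2 - m₁) q(u) +
o(‖u‖²)`, which is eventually nonpositive because `m₁ < 1/2`. The bound `‖η‖ ≤ ρ` excludes long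
directions that `R_x` happens to send near `x*`; `ρ` comes from the retraction estimate alone, hence
does not depend on `f` or `m₁`. -/

namespace RiemLineSearch

/-! ### Chart lines as smooth curves on the submanifold -/

section ChartCurves

variable {E : Type*} [NormedAddCommGroup E] [InnerProductSpace ℝ E]
  {F : Type*} [NormedAddCommGroup F] [NormedSpace ℝ F]

theorem hasDerivAt_comp_line {φ : F → E} {u : F} (hφ : DifferentiableAt ℝ φ u) (w : F) :
    HasDerivAt (fun s : ℝ => φ (u + s • w)) (fderiv ℝ φ u w) 0 := by
  have hl : HasDerivAt (fun s : ℝ => u + s • w) w 0 := by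
    simpa using ((hasDerivAt_id (0 : ℝ)).smul_const w).const_add u
  have h : HasFDerivAt φ (fderiv ℝ φ u) (u + (0 : ℝ) • w) := by
    simpa using hφ.hasFDerivAt
  exact h.comp_hasDerivAt (0 : ℝ) hl

theorem isSmoothCurveAt_comp_line {M : Set E} {φ : F → E} {U : Set F} (hU : IsOpen U)
    (hφ : ContDiffOn ℝ 2 φ U) (hM : MapsTo φ U M) {u : F} (hu : u ∈ U) (w : F) :
    IsSmoothCurveAt M (φ u) (fun s : ℝ => φ (u + s • w)) where
  contDiffAt := by
    have h : ContDiffAt ℝ 2 φ (u + (0 : ℝ) • w) := by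
      simpa using hφ.contDiffAt (hU.mem_nhds hu)
    exact h.comp (0 : ℝ) (by fun_prop)
  eventually_mem := by
    have h : ContinuousAt (fun s : ℝ => u + s • w) 0 := by fun_prop
    filter_upwards [h.eventually_mem (hU.mem_nhds (by simpa using hu))] with s hs
    exact hM hs
  map_zero := by simp

theorem fderiv_mem_tangentAt {M : Set E} {φ : F → E} {U : Set F} (hU : IsOpen U)
    (hφ : ContDiffOn ℝ 2 φ U) (hM : MapsTo φ U M) {u : F} (hu : u ∈ U) (w : F) :
    fderiv ℝ φ u w ∈ tangentAt M (φ u) :=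
  Submodule.subset_span ⟨_, isSmoothCurveAt_comp_line hU hφ hM hu w,
    (hasDerivAt_comp_line ((hφ.contDiffAt (hU.mem_nhds hu)).differentiableAt (by norm_num))
      w).deriv⟩

end ChartCurves

/-! ### Riemannian gradient and Hessian -/

section Gradient

variable {E : Type*} [NormedAddCommGroup E] [InnerProductSpace ℝ E]

theorem isRiemGradAt_riemGrad [FiniteDimensional ℝ E] {M : Set E} {f : E → ℝ} {x : E}
    (hf : DifferentiableWithinAt ℝ f M x) : IsRiemGradAt M f x (riemGrad M f x) := by
  have h : ∃ g, IsRiemGradAt M f x g := by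
    -- Any derivative of `f` within `M` will do: it is only evaluated on velocities, and projecting
    -- its dual vector does not change the inner products with tangent vectors.
    set D := fderivWithin ℝ f M x
    refine ⟨(tangentAt M x).starProjection ((InnerProductSpace.toDual ℝ E).symm D),
      Submodule.starProjection_apply_mem _ _, fun c hc => ?_⟩
    have h1 : HasFDerivWithinAt f D M (c 0) := by
      rw [hc.map_zero]
      exact hf.hasFDerivWithinAt
    have h2 := h1.comp_hasDerivAt 0
      (hc.contDiffAt.differentiableAt (by norm_num)).hasDerivAt hc.eventually_mem
    have hv : deriv c 0 ∈ tangentAt M x := Submodule.subset_span ⟨c, hc, rfl⟩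
    rwa [Submodule.inner_starProjection_left_eq_right,
      Submodule.starProjection_eq_self_iff.2 hv, InnerProductSpace.toDual_symm_apply]
  rw [riemGrad, dif_pos h]
  exact h.choose_spec

theorem IsRiemGradAt.eq_zero_of_isLocalMinOn {p : ℕ} {M : Set E} {f : E → ℝ} {x g : E}
    (hM : IsC2SubmanifoldAt p M x) (hg : IsRiemGradAt M f x g) (hf : IsLocalMinOn f M x) :
    g = 0 := by
  -- The gradient is itself a velocity; along a curve with this velocity, `f ∘ c` has derivative
  -- `‖g‖²`, which vanishes at a minimum.
  obtain ⟨c, hc, hcg⟩ := (mem_tangentAt_iff hM).1 hg.1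
  have hmin : IsLocalMin (f ∘ c) 0 := by
    have hc0 : Tendsto c (𝓝 0) (𝓝[M] x) := by
      refine tendsto_nhdsWithin_iff.2 ⟨?_, hc.eventually_mem⟩
      simpa [hc.map_zero] using hc.contDiffAt.continuousAt.tendsto
    filter_upwards [hc0.eventually hf] with t ht
    simpa [hc.map_zero] using ht
  have h := hmin.hasDerivAt_eq_zero (hg.2 c hc)
  rw [hcg] at h
  exact inner_self_eq_zero.1 h

/-- The projection in the Hessian is self-adjoint and fixes tangent vectors, so it disappears from
the quadratic form. -/
theorem inner_riemHess [FiniteDimensional ℝ E] {M : Set E} {f : E → ℝ} {x : E} {c : ℝ → E}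
    (hf : DifferentiableWithinAt ℝ (riemGrad M f) M x) (hc : IsSmoothCurveAt M x c) :
    inner ℝ (riemHess M f x (deriv c 0)) (deriv c 0) =
      inner ℝ (fderivWithin ℝ (riemGrad M f) M x (deriv c 0)) (deriv c 0) := by
  have h1 : HasFDerivWithinAt (riemGrad M f) (fderivWithin ℝ (riemGrad M f) M x) M (c 0) := by
    rw [hc.map_zero]
    exact hf.hasFDerivWithinAt
  have h2 := (h1.comp_hasDerivAt 0
      (hc.contDiffAt.differentiableAt (by norm_num)).hasDerivAt hc.eventually_mem).deriv
  have hv : deriv c 0 ∈ tangentAt M (c 0) := by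
    rw [hc.map_zero]
    exact Submodule.subset_span ⟨c, hc, rfl⟩
  rw [riemHess_eq hf hc, covDeriv, h2, Submodule.inner_starProjection_left_eq_right,
    Submodule.starProjection_eq_self_iff.2 hv]

end Gradient

/-! ### Comparison of the Riemannian distance with norms -/

section Distance

variable {E : Type*} [NormedAddCommGroup E] [InnerProductSpace ℝ E]
  {F : Type*} [NormedAddCommGroup F] [NormedSpace ℝ F]

theorem enorm_sub_le_riemDist [CompleteSpace E] (M : Set E) (x y : E) :
    ‖x - y‖ₑ ≤ riemDist M x y := by
  refine le_iInf₂ fun c hc => ?_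
  obtain ⟨h1, -, rfl, rfl⟩ := hc
  rw [← enorm_neg, neg_sub]
  exact enorm_sub_le_lintegral_derivWithin_Icc_of_contDiffOn_Icc
    (h1.of_le (by norm_num)) zero_le_one

/-- The image under `φ` of the segment from `u` to `0` is an admissible curve, and its speed is at
most `K ‖u‖` because `fderiv ℝ φ` is bounded near `0`. -/
theorem eventually_riemDist_le {M : Set E} {φ : F → E} {U : Set F} (hU : IsOpen U)
    (hφ : ContDiffOn ℝ 2 φ U) (hM : MapsTo φ U M) (h0 : (0 : F) ∈ U) :
    ∃ K : ℝ≥0, ∀ᶠ u in 𝓝 (0 : F), riemDist M (φ u) (φ 0) ≤ K * ‖u‖ₑ := by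
  have hcont : ContinuousAt (fderiv ℝ φ) 0 :=
    (hφ.contDiffAt (hU.mem_nhds h0)).continuousAt_fderiv (by norm_num)
  refine ⟨‖fderiv ℝ φ 0‖₊ + 1, ?_⟩
  have h1 : ∀ᶠ u in 𝓝 (0 : F), u ∈ U ∧ ‖fderiv ℝ φ u‖₊ ≤ ‖fderiv ℝ φ 0‖₊ + 1 :=
    Filter.Eventually.and (hU.mem_nhds h0)
      ((hcont.nnnorm.eventually_lt_const (lt_add_one _)).mono fun _ h => h.le)
  obtain ⟨r, hr, hball⟩ := Metric.eventually_nhds_iff_ball.1 h1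
  filter_upwards [Metric.ball_mem_nhds (0 : F) hr] with u hu
  have hmem : ∀ t ∈ Icc (0 : ℝ) 1, (1 - t) • u ∈ Metric.ball (0 : F) r := by
    intro t ht
    rw [mem_ball_zero_iff] at hu ⊢
    refine lt_of_le_of_lt ?_ hu
    rw [norm_smul, Real.norm_of_nonneg (by linarith [ht.2])]
    exact mul_le_of_le_one_left (norm_nonneg _) (by linarith [ht.1])
  have hc : ContDiffOn ℝ 2 (fun t : ℝ => φ ((1 - t) • u)) (Icc 0 1) ∧
      MapsTo (fun t : ℝ => φ ((1 - t) • u)) (Icc 0 1) M ∧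
      φ ((1 - (0 : ℝ)) • u) = φ u ∧ φ ((1 - (1 : ℝ)) • u) = φ 0 :=
    ⟨hφ.comp (t := U) (f := fun t : ℝ => (1 - t) • u) (by fun_prop)
      fun t ht => (hball _ (hmem t ht)).1,
      fun t ht => hM (hball _ (hmem t ht)).1, by simp, by simp⟩
  calc riemDist M (φ u) (φ 0)
      ≤ ∫⁻ t in Icc (0 : ℝ) 1, ‖derivWithin (fun t : ℝ => φ ((1 - t) • u)) (Icc 0 1) t‖ₑ :=
        iInf₂_le (fun t : ℝ => φ ((1 - t) • u)) hc
    _ ≤ ∫⁻ t in Icc (0 : ℝ) 1, ((‖fderiv ℝ φ 0‖₊ + 1 : ℝ≥0) : ℝ≥0∞) * ‖u‖ₑ := by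
        refine setLIntegral_mono' measurableSet_Icc fun t ht => ?_
        have hl : HasDerivAt (fun t : ℝ => (1 - t) • u) (-u) t := by
          simpa using ((hasDerivAt_id t).const_sub 1).smul_const u
        have hb := hball _ (hmem t ht)
        have hd : HasDerivAt (fun t : ℝ => φ ((1 - t) • u))
            (fderiv ℝ φ ((1 - t) • u) (-u)) t :=
          ((hφ.contDiffAt (hU.mem_nhds hb.1)).differentiableAt
            (by norm_num)).hasFDerivAt.comp_hasDerivAt t hl
        rw [hd.hasDerivWithinAt.derivWithin (uniqueDiffOn_Icc zero_lt_one t ht), map_neg,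
          enorm_neg]
        refine (ContinuousLinearMap.le_opENorm _ _).trans ?_
        gcongr
        exact ENNReal.coe_le_coe.2 hb.2
    _ = _ := by simp

end Distance

/-! ### Uniform first-order expansion of a retraction -/

section Retraction

variable {E : Type*} [NormedAddCommGroup E] [InnerProductSpace ℝ E]

/-- The point is uniformity in `x`: joint continuity of the derivative on the tangent bundle keeps
it close to its value at `(xs, 0)`, and the mean value inequality is applied to `t ↦ R_x(t v) - t
v`. -/
theorem IsRetraction.norm_sub_sub_le {M : Set E} {R : E → E → E} (hR : IsRetraction M R)
    {xs : E} (hxs : xs ∈ M) {ε : ℝ} (hε : 0 < ε) :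
    ∃ δ > 0, ∀ x ∈ M, ∀ v ∈ tangentAt M x, ‖x - xs‖ < δ → ‖v‖ < δ →
      ‖R x v - x - v‖ ≤ ε * ‖v‖ := by
  have hq : ((xs, 0) : E × E) ∈ tangentBundle M := ⟨hxs, Submodule.zero_mem _⟩
  have hd := hR.contDiffOn _ hq
  rw [show (1 : WithTop ℕ∞) = 0 + 1 by norm_num,
    contDiffWithinAt_succ_iff_hasFDerivWithinAt' (by norm_num), insert_eq_of_mem hq] at hd
  obtain ⟨u, hu, -, -, L, hL, hLc⟩ := hd
  have h1 : ∀ᶠ q in 𝓝[tangentBundle M] ((xs, 0) : E × E), q ∈ u ∧ ‖L q - L (xs, 0)‖ < ε / 2 := by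
    refine Filter.Eventually.and hu ?_
    have := Metric.tendsto_nhds.1 hLc.continuousWithinAt.tendsto (ε / 2) (half_pos hε)
    simpa only [dist_eq_norm] using this
  obtain ⟨δ, hδ, hball⟩ := Metric.mem_nhdsWithin_iff.1 h1
  have key : ∀ x ∈ M, ∀ v ∈ tangentAt M x, ‖x - xs‖ < δ → ‖v‖ < δ →
      HasFDerivWithinAt (fun q : E × E => R q.1 q.2) (L (x, v)) (tangentBundle M) (x, v) ∧
      ‖L (x, v) - L (xs, 0)‖ < ε / 2 := by
    intro x hx v hv hxδ hvδ
    have := hball (a := (x, v)) ⟨?_, hx, hv⟩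
    · exact ⟨hL _ this.1, this.2⟩
    · rw [mem_ball_iff_norm]
      simpa [Prod.norm_def] using ⟨hxδ, hvδ⟩
  refine ⟨δ, hδ, fun x hx v hv hxδ hvδ => ?_⟩
  have hsmul : ∀ t ∈ Icc (0 : ℝ) 1, ‖t • v‖ < δ := by
    intro t ht
    refine lt_of_le_of_lt ?_ hvδ
    rw [norm_smul, Real.norm_of_nonneg ht.1]
    exact mul_le_of_le_one_left (norm_nonneg _) ht.2
  have hderiv : ∀ t ∈ Icc (0 : ℝ) 1,
      HasDerivAt (fun t : ℝ => R x (t • v)) (L (x, t • v) (0, v)) t := by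
    intro t ht
    have hl : HasDerivAt (fun t : ℝ => (x, t • v)) ((0, v) : E × E) t :=
      (hasDerivAt_const t x).prodMk (by simpa using (hasDerivAt_id t).smul_const v)
    have hm : ∀ s : ℝ, (x, s • v) ∈ tangentBundle M := fun s => ⟨hx, Submodule.smul_mem _ s hv⟩
    exact (key x hx _ (Submodule.smul_mem _ t hv) hxδ (hsmul t ht)).1.comp_hasDerivAt t hl
      (Eventually.of_forall hm)
  -- Derivatives within the tangent bundle need not be unique as linear maps, so `L` is compared
  -- with `D R_x(0) = id` along the curve `t ↦ t v`.
  have h0 : L (x, 0) (0, v) = v := by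
    have ha := hderiv 0 (by simp)
    rw [zero_smul] at ha
    have hb : HasFDerivWithinAt (R x) (ContinuousLinearMap.id ℝ E) (tangentAt M x : Set E)
        ((0 : ℝ) • v) := by
      simpa using hR.hasFDerivWithinAt_zero x hx
    have hl : HasDerivAt (fun t : ℝ => t • v) v 0 := by
      simpa using (hasDerivAt_id (0 : ℝ)).smul_const v
    have hc := hb.comp_hasDerivAt (0 : ℝ) hl
      (Eventually.of_forall fun s => Submodule.smul_mem _ s hv)
    exact ha.unique hc
  have hmv := norm_image_sub_le_of_norm_deriv_le_segment_01' (C := ε * ‖v‖)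
    (f := fun t : ℝ => R x (t • v) - t • v) (f' := fun t => L (x, t • v) (0, v) - v)
    (fun t ht => ((hderiv t ht).sub
      (by simpa using (hasDerivAt_id t).smul_const v)).hasDerivWithinAt) ?_
  · simp only [one_smul, zero_smul, sub_zero, hR.map_zero x hx] at hmv
    rwa [sub_right_comm]
  · intro t ht
    have ha := (key x hx _ (Submodule.smul_mem _ t hv) hxδ (hsmul t ⟨ht.1, ht.2.le⟩)).2
    have hb := (key x hx 0 (Submodule.zero_mem _) hxδ (by simpa using hδ)).2
    have hab : ‖L (x, t • v) - L (x, 0)‖ ≤ ε := by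
      have := norm_sub_le (L (x, t • v) - L (xs, 0)) (L (x, 0) - L (xs, 0))
      rw [sub_sub_sub_cancel_right] at this
      linarith
    calc ‖L (x, t • v) (0, v) - v‖ = ‖(L (x, t • v) - L (x, 0)) (0, v)‖ := by
          rw [sub_apply, h0]
      _ ≤ ε * ‖((0, v) : E × E)‖ := ContinuousLinearMap.le_of_opNorm_le _ hab _
      _ = ε * ‖v‖ := by simp [Prod.norm_def]

end Retraction

/-! ### Expansions of the gradient and of the function in a chart -/

section Taylor

open Asymptotics

variable {E : Type*} [NormedAddCommGroup E] [InnerProductSpace ℝ E]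
  {F : Type*} [NormedAddCommGroup F] [NormedSpace ℝ F]

theorem riemGrad_comp_sub_isLittleO {M : Set E} {f : E → ℝ} {φ : F → E} {U : Set F}
    (hU : IsOpen U) (hφ : ContDiffOn ℝ 2 φ U) (hM : MapsTo φ U M) (h0 : (0 : F) ∈ U)
    (hg : DifferentiableWithinAt ℝ (riemGrad M f) M (φ 0)) (hg0 : riemGrad M f (φ 0) = 0) :
    (fun u => riemGrad M f (φ u) -
      fderivWithin ℝ (riemGrad M f) M (φ 0) (fderiv ℝ φ 0 u)) =o[𝓝 0] fun u : F => u := by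
  have h := hg.hasFDerivWithinAt.comp_hasFDerivAt 0
    ((hφ.contDiffAt (hU.mem_nhds h0)).differentiableAt (by norm_num)).hasFDerivAt
    (by filter_upwards [hU.mem_nhds h0] with u hu using hM hu)
  simpa [hg0] using h.isLittleO

/-- Differentiability of the gradient at the single point `φ 0` suffices: along the ray `t ↦ t u`,
the derivative of `f ∘ φ` differs from that of `t² q(u) / 2` by at most `ε ‖u‖²`, and the mean value
inequality concludes. Symmetry of `A` is not needed, since `q` is only differentiated along rays. -/
theorem taylor_two_comp_isLittleO [FiniteDimensional ℝ E] {M : Set E} {f : E → ℝ} {φ : F → E}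
    {U : Set F} (hU : IsOpen U) (hφ : ContDiffOn ℝ 2 φ U) (hM : MapsTo φ U M) (h0 : (0 : F) ∈ U)
    (hf : DifferentiableOn ℝ f M)
    (hg : DifferentiableWithinAt ℝ (riemGrad M f) M (φ 0)) (hg0 : riemGrad M f (φ 0) = 0) :
    (fun u => f (φ u) - f (φ 0) - 1 / 2 *
      inner ℝ (fderivWithin ℝ (riemGrad M f) M (φ 0) (fderiv ℝ φ 0 u)) (fderiv ℝ φ 0 u))
      =o[𝓝 0] fun u : F => ‖u‖ ^ 2 := by
  have hgo := riemGrad_comp_sub_isLittleO hU hφ hM h0 hg hg0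
  set A := fderivWithin ℝ (riemGrad M f) M (φ 0)
  set B := fderiv ℝ φ 0 with hB
  have hcont : ContinuousAt (fderiv ℝ φ) 0 :=
    (hφ.contDiffAt (hU.mem_nhds h0)).continuousAt_fderiv (by norm_num)
  have h1 : (fun u => ‖riemGrad M f (φ u) - A (B u)‖ * ‖fderiv ℝ φ u‖) =o[𝓝 0]
      fun u : F => ‖u‖ * 1 :=
    hgo.norm_norm.mul_isBigO (hcont.norm.isBigO_one ℝ)
  have h2 : (fun u => ‖A (B u)‖ * ‖fderiv ℝ φ u - B‖) =o[𝓝 0] fun u : F => ‖u‖ * 1 := by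
    refine ((A.comp B).isBigO_id _).norm_norm.mul_isLittleO ((isLittleO_one_iff ℝ).2 ?_)
    have := (hcont.tendsto.sub_const B).norm
    simpa [hB] using this
  refine IsLittleO.of_bound fun ε hε => ?_
  have h3 := ((h1.add h2).bound hε).and (hU.mem_nhds h0)
  obtain ⟨r, hr, hball⟩ := Metric.eventually_nhds_iff_ball.1 h3
  filter_upwards [Metric.ball_mem_nhds (0 : F) hr] with u hu
  have hmem : ∀ t ∈ Icc (0 : ℝ) 1, t • u ∈ Metric.ball (0 : F) r := by
    intro t ht
    rw [mem_ball_zero_iff] at hu ⊢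
    refine lt_of_le_of_lt ?_ hu
    rw [norm_smul, Real.norm_of_nonneg ht.1]
    exact mul_le_of_le_one_left (norm_nonneg _) ht.2
  have hderiv : ∀ t ∈ Icc (0 : ℝ) 1, HasDerivAt (fun t : ℝ => f (φ (t • u)))
      (inner ℝ (riemGrad M f (φ (t • u))) (fderiv ℝ φ (t • u) u)) t := by
    intro t ht
    have htU := (hball _ (hmem t ht)).2
    have hc := isSmoothCurveAt_comp_line hU hφ hM htU u
    have h4 := (isRiemGradAt_riemGrad (hf _ (hM htU))).2 _ hc
    rw [(hasDerivAt_comp_line ((hφ.contDiffAt (hU.mem_nhds htU)).differentiableAt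
      (by norm_num)) u).deriv, ← sub_self t] at h4
    -- Time shift: the curve based at `φ (t • u)` at time `0` becomes the ray at time `t`.
    have h5 := h4.comp_sub_const t t
    refine h5.congr_of_eventuallyEq (Eventually.of_forall fun s => ?_)
    change f (φ (s • u)) = f (φ (t • u + (s - t) • u))
    rw [← add_smul, add_sub_cancel]
  have hq : ∀ t : ℝ, HasDerivAt (fun t : ℝ => 1 / 2 * inner ℝ (A (B u)) (B u) * t ^ 2)
      (inner ℝ (A (B (t • u))) (B u)) t := by
    intro t
    have := (hasDerivAt_pow 2 t).const_mul (1 / 2 * inner ℝ (A (B u)) (B u))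
    have heq : inner ℝ (A (B (t • u))) (B u) =
        1 / 2 * inner ℝ (A (B u)) (B u) * (((2 : ℕ) : ℝ) * t ^ (2 - 1)) := by
      rw [map_smul, map_smul, real_inner_smul_left]
      push_cast
      ring
    rwa [heq]
  have hmv := norm_image_sub_le_of_norm_deriv_le_segment_01' (C := ε * ‖u‖ ^ 2)
    (fun t ht => ((hderiv t ht).sub (hq t)).hasDerivWithinAt) ?_
  · simp only [Pi.sub_apply, one_smul, zero_smul] at hmv
    rw [norm_pow, norm_norm]
    refine le_of_eq_of_le (congrArg _ ?_) hmv
    ring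
  · intro t ht
    have ht' : t ∈ Icc (0 : ℝ) 1 := ⟨ht.1, ht.2.le⟩
    have hb := (hball _ (hmem t ht')).1
    set v := t • u
    rw [Real.norm_of_nonneg (by positivity), mul_one, norm_norm] at hb
    have hsplit : inner ℝ (riemGrad M f (φ v)) (fderiv ℝ φ v u) - inner ℝ (A (B v)) (B u) =
        inner ℝ (riemGrad M f (φ v) - A (B v)) (fderiv ℝ φ v u) +
          inner ℝ (A (B v)) ((fderiv ℝ φ v - B) u) := by
      rw [sub_apply, inner_sub_left, inner_sub_right]
      ring
    rw [hsplit]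
    have hvu : ‖v‖ ≤ ‖u‖ := by
      rw [norm_smul, Real.norm_of_nonneg ht.1]
      exact mul_le_of_le_one_left (norm_nonneg _) ht.2.le
    calc _ ≤ ‖riemGrad M f (φ v) - A (B v)‖ * (‖fderiv ℝ φ v‖ * ‖u‖) +
          ‖A (B v)‖ * (‖fderiv ℝ φ v - B‖ * ‖u‖) := by
          refine (norm_add_le _ _).trans (add_le_add ?_ ?_) <;>
          · refine (norm_inner_le_norm _ _).trans ?_
            gcongr
            exact ContinuousLinearMap.le_opNorm _ _
      _ = (‖riemGrad M f (φ v) - A (B v)‖ * ‖fderiv ℝ φ v‖ +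
          ‖A (B v)‖ * ‖fderiv ℝ φ v - B‖) * ‖u‖ := by ring
      _ ≤ ε * ‖v‖ * ‖u‖ := by gcongr
      _ ≤ ε * ‖u‖ * ‖u‖ := by gcongr
      _ = ε * ‖u‖ ^ 2 := by ring

end Taylor

/-! ### Coercivity, and superlinear improvement in norm -/

section Superlinear

open Asymptotics

variable {E : Type*} [NormedAddCommGroup E] [InnerProductSpace ℝ E]
  {F : Type*} [NormedAddCommGroup F]

theorem exists_pos_mul_norm_sq_le [NormedSpace ℝ F] [FiniteDimensional ℝ F] (S T : F →L[ℝ] E)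
    (h : ∀ u ≠ 0, 0 < inner ℝ (S u) (T u)) :
    ∃ a > 0, ∀ u, a * ‖u‖ ^ 2 ≤ inner ℝ (S u) (T u) := by
  have : ProperSpace F := FiniteDimensional.proper ℝ F
  obtain ⟨a, ha, hau⟩ := (isCompact_sphere (0 : F) 1).exists_forall_le'
    (f := fun u => inner ℝ (S u) (T u)) (a := 0) (by fun_prop)
    (fun u hu => h u (by rintro rfl; simp at hu))
  refine ⟨a, ha, fun u => ?_⟩
  rcases eq_or_ne u 0 with rfl | hu
  · simp
  · have h1 := hau (‖u‖⁻¹ • u) (by simp [norm_smul, hu])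
    have hu' : 0 < ‖u‖ := norm_pos_iff.2 hu
    rw [map_smul, map_smul, real_inner_smul_left, real_inner_smul_right, ← mul_assoc,
      ← mul_inv, ← sq, inv_mul_eq_div, le_div_iff₀ (by positivity)] at h1
    exact h1

/-- The distance from the new point is bounded below by the chord, and only the distance from `x i`
needs an upper bound by the chart coordinate. -/
theorem SuperlinearImprovement.sub_isLittleO [CompleteSpace E] {ι : Type*} {M : Set E}
    {R : E → E → E} {y : E} {l : Filter ι} {x η : ι → E} {u : ι → F}
    (h : SuperlinearImprovement M R y l x η) {K : ℝ≥0}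
    (hK : ∀ᶠ i in l, riemDist M (x i) y ≤ K * ‖u i‖ₑ) :
    (fun i => R (x i) (η i) - y) =o[l] u := by
  refine IsLittleO.of_bound fun ε hε => ?_
  lift ε to ℝ≥0 using hε.le
  have hε' : 0 < ε := hε
  -- `K + 1` instead of `K`, which may be zero.
  filter_upwards [h (ε / (K + 1)) (by positivity), hK] with i h1 h2
  have h3 : ‖R (x i) (η i) - y‖ₑ ≤ ((ε / (K + 1) * (K * ‖u i‖₊) : ℝ≥0) : ℝ≥0∞) := by
    push_cast
    exact ((enorm_sub_le_riemDist M _ _).trans h1).trans (by gcongr; exact h2)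
  have h4 : ‖R (x i) (η i) - y‖₊ ≤ ε / (K + 1) * (K * ‖u i‖₊) := ENNReal.coe_le_coe.1 h3
  have h5 : ε / (K + 1) * (K * ‖u i‖₊) ≤ ε * ‖u i‖₊ := by
    rw [← mul_assoc]
    gcongr
    rw [div_mul_eq_mul_div]
    exact div_le_of_le_mul₀ (by positivity) (by positivity) (by gcongr; simp)
  exact_mod_cast h4.trans h5

end Superlinear

/-! ### Superlinear directions are Newton-like -/

section Direction

open Asymptotics

variable {E : Type*} [NormedAddCommGroup E] [InnerProductSpace ℝ E]
  {F : Type*} [NormedAddCommGroup F]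

/-- Directions in a small ball that bring a superlinear improvement are the Newton-like directions
`xs - x` up to `o(x - xs)`. -/
theorem IsRetraction.exists_direction_isLittleO {M : Set E} {R : E → E → E}
    (hR : IsRetraction M R) {xs : E} (hxs : xs ∈ M) :
    ∃ ρ > 0, ∀ {ι : Type*} {l : Filter ι} {x η : ι → E} {u : ι → F}, (∀ᶠ i in l, x i ∈ M) →
      (∀ᶠ i in l, η i ∈ tangentAt M (x i)) → Tendsto x l (𝓝 xs) → (∀ᶠ i in l, ‖η i‖ ≤ ρ) →
      Tendsto u l (𝓝 0) → (fun i => x i - xs) =O[l] u → (fun i => R (x i) (η i) - xs) =o[l] u →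
      η =O[l] u ∧ (fun i => η i + (x i - xs)) =o[l] u := by
  obtain ⟨δ, hδ, hball⟩ := hR.norm_sub_sub_le hxs (ε := 1 / 2) (by norm_num)
  refine ⟨δ / 2, half_pos hδ, fun {ι l x η u} hx hη hxlim hηρ hu hxu hyu => ?_⟩
  have hnear : ∀ δ > 0, ∀ᶠ i in l, ‖x i - xs‖ < δ := fun δ hδ => by
    simpa only [dist_eq_norm] using Metric.tendsto_nhds.1 hxlim δ hδ
  have hyx : (fun i => R (x i) (η i) - x i) =O[l] u := by
    simpa using hyu.isBigO.sub hxu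
  have hηO : η =O[l] u := by
    -- With relative error `1/2` in the retraction, `‖η‖ ≤ ‖R_x(η) - x‖ + ‖η‖/2`. This is where the
    -- bound by `ρ` is used; afterwards `η → 0`, and the error can be made `o(η)`.
    refine IsBigO.trans (IsBigO.of_bound 2 ?_) hyx
    filter_upwards [hx, hη, hηρ, hnear δ hδ] with i h1 h2 h3 h4
    have h5 := hball _ h1 _ h2 h4 (by linarith)
    have h6 := norm_sub_norm_le (η i) (R (x i) (η i) - x i)
    rw [norm_sub_rev (η i)] at h6
    linarith
  refine ⟨hηO, ?_⟩
  have hη0 : Tendsto η l (𝓝 0) := hηO.trans_tendsto hu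
  have hRo : (fun i => R (x i) (η i) - x i - η i) =o[l] η := by
    refine IsLittleO.of_bound fun ε hε => ?_
    obtain ⟨δ', hδ', hball'⟩ := hR.norm_sub_sub_le hxs hε
    filter_upwards [hx, hη, hnear δ' hδ', Metric.tendsto_nhds.1 hη0 δ' hδ'] with i h1 h2 h3 h4
    exact hball' _ h1 _ h2 h3 (by simpa using h4)
  refine (hyu.sub (hRo.trans_isBigO hηO)).congr_left fun i => ?_
  abel

end Direction

end RiemLineSearch

/-! ### The Armijo condition for the unit step -/

open RiemLineSearch Asymptotics in
theorem mainTheorem6 {E : Type*} [NormedAddCommGroup E] [InnerProductSpace ℝ E]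
    [FiniteDimensional ℝ E] {p : ℕ} {M : Set E} (hM : RiemLineSearch.IsC2Submanifold p M)
    {R : E → E → E} (hR : RiemLineSearch.IsRetraction M R) {xs : E} (hxs : xs ∈ M) :
    ∃ ρ : ℝ, 0 < ρ ∧
      ∀ f : E → ℝ, RiemLineSearch.TwiceDifferentiableOn M f →
        RiemLineSearch.IsStrongLocalMin M f xs →
      ∀ m₁ : ℝ, 0 < m₁ → m₁ < 1 / 2 →
      ∀ (ι : Type*) (l : Filter ι) (x η : ι → E),
        (∀ᶠ i in l, x i ∈ M) → (∀ᶠ i in l, η i ∈ RiemLineSearch.tangentAt M (x i)) →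
        Tendsto x l (𝓝 xs) → (∀ᶠ i in l, ‖η i‖ ≤ ρ) →
        RiemLineSearch.SuperlinearImprovement M R xs l x η →
        ∀ᶠ i in l, RiemLineSearch.Armijo M R f m₁ 1 (x i) (η i) := by
  obtain ⟨φ, ψ, U, V, hU, h0U, hV, hxV, hφ, hψ, rfl, hφU, hψφ, hinj⟩ := hM xs hxs
  obtain ⟨ρ, hρ, hdir⟩ :=
    hR.exists_direction_isLittleO (F := EuclideanSpace ℝ (Fin p)) hxs
  refine ⟨ρ, hρ, fun f hf hmin m₁ _ hm₁ ι l x η hx hη hxlim hηρ hsup => ?_⟩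
  have hmaps : MapsTo φ U M := fun u hu => (hφU ▸ mem_image_of_mem φ hu : φ u ∈ M ∩ V).1
  have hφψ : ∀ z ∈ M, z ∈ V → φ (ψ z) = z := by
    intro z hz hzV
    obtain ⟨u, hu, rfl⟩ : z ∈ φ '' U := hφU ▸ ⟨hz, hzV⟩
    rw [hψφ u hu]
  have hφd : DifferentiableAt ℝ φ 0 :=
    (hφ.contDiffAt (hU.mem_nhds h0U)).differentiableAt (by norm_num)
  have hψd : DifferentiableAt ℝ ψ (φ 0) :=
    (hψ.contDiffAt (hV.mem_nhds hxV)).differentiableAt (by norm_num)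
  have hchart : ∀ {z : ι → E}, (∀ᶠ i in l, z i ∈ M) → Tendsto z l (𝓝 (φ 0)) →
      Tendsto (fun i => ψ (z i)) l (𝓝 0) ∧ ∀ᶠ i in l, φ (ψ (z i)) = z i := by
    intro z hz hzlim
    refine ⟨by simpa [Function.comp_def, hψφ 0 h0U] using hψd.continuousAt.tendsto.comp hzlim, ?_⟩
    filter_upwards [hz, hzlim.eventually (hV.mem_nhds hxV)] with i h1 h2 using hφψ _ h1 h2
  have hg := hf.2 _ hxs
  have hg0 : riemGrad M f (φ 0) = 0 :=
    (isRiemGradAt_riemGrad (hf.1 _ hxs)).eq_zero_of_isLocalMinOn (hM _ hxs) hmin.1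
  have hgo := riemGrad_comp_sub_isLittleO hU hφ hmaps h0U hg hg0
  have htaylor := taylor_two_comp_isLittleO hU hφ hmaps h0U hf.1 hg hg0
  set A := fderivWithin ℝ (riemGrad M f) M (φ 0) with hA
  set B := fderiv ℝ φ 0 with hB
  obtain ⟨a, ha, hq⟩ := exists_pos_mul_norm_sq_le (A.comp B) B fun w hw => by
    have hc := isSmoothCurveAt_comp_line hU hφ hmaps h0U w
    have hd := (hasDerivAt_comp_line hφd w).deriv
    have h1 := inner_riemHess hg hc
    rw [hd, ← hA, ← hB] at h1
    rw [ContinuousLinearMap.comp_apply, ← h1]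
    exact hmin.2 _ (fderiv_mem_tangentAt hU hφ hmaps h0U w)
      ((map_ne_zero_iff B hinj).2 hw)
  obtain ⟨hu, hφu⟩ := hchart hx hxlim
  set u := fun i => ψ (x i) with hu_def
  have hxB : (fun i => x i - φ 0 - B (u i)) =o[l] u := by
    have h1 := (hφd.hasFDerivAt.isLittleO.comp_tendsto hu)
    refine h1.congr' ?_ (Eventually.of_forall fun i => by simp)
    filter_upwards [hφu] with i hi
    simp [hu_def, hi, ← hB]
  have hBu : (fun i => B (u i)) =O[l] u := B.isBigO_comp _ _
  have hABu : (fun i => A (B (u i))) =O[l] u := (A.comp B).isBigO_comp _ _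
  have hxO : (fun i => x i - φ 0) =O[l] u := by
    simpa using hxB.isBigO.add hBu
  obtain ⟨K, hK⟩ := eventually_riemDist_le hU hφ hmaps h0U
  have hyo : (fun i => R (x i) (η i) - φ 0) =o[l] u := by
    refine hsup.sub_isLittleO (K := K) ?_
    filter_upwards [hu.eventually hK, hφu] with i h1 h2
    rwa [h2] at h1
  obtain ⟨hηO, hηo⟩ := hdir hx hη hxlim hηρ hu hxO hyo
  have hηB : (fun i => η i + B (u i)) =o[l] u := by
    refine (hηo.sub hxB).congr_left fun i => ?_
    abel
  have hyM : ∀ᶠ i in l, R (x i) (η i) ∈ M := by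
    filter_upwards [hx, hη] with i h1 h2 using hR.mem _ h1 _ h2
  have hylim : Tendsto (fun i => R (x i) (η i)) l (𝓝 (φ 0)) :=
    tendsto_sub_nhds_zero_iff.1 (hyo.trans_tendsto hu)
  obtain ⟨hv, hφv⟩ := hchart hyM hylim
  set v := fun i => ψ (R (x i) (η i)) with hv_def
  -- `ψ` is differentiable at `φ 0`, so chart coordinates are controlled by the norm in `E`.
  have hvo : v =o[l] u := by
    have h1 := (hψd.isBigO_sub.comp_tendsto hylim)
    simp only [Function.comp_def, hψφ 0 h0U, sub_zero] at h1
    exact h1.trans_isLittleO hyo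
  have hsq : (fun i => ‖v i‖ ^ 2) =o[l] fun i => ‖u i‖ ^ 2 :=
    hvo.norm_norm.pow two_pos
  have hfy : (fun i => f (R (x i) (η i)) - f (φ 0)) =o[l] fun i => ‖u i‖ ^ 2 := by
    have h1 := (htaylor.comp_tendsto hv).trans hsq
    have h2 : (fun i => 1 / 2 * inner ℝ (A (B (v i))) (B (v i))) =o[l] fun i => ‖u i‖ ^ 2 := by
      refine IsBigO.trans_isLittleO (IsBigO.const_mul_left ?_ _) hsq
      refine (IsBigO.of_bound 1 (Eventually.of_forall fun i => ?_)).trans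
        ((((A.comp B).isBigO_comp v l).norm_norm.mul (B.isBigO_comp v l).norm_norm).congr_right
          fun i => (sq _).symm)
      simpa using norm_inner_le_norm (𝕜 := ℝ) (A (B (v i))) (B (v i))
    refine (h1.add h2).congr' ?_ EventuallyEq.rfl
    filter_upwards [hφv] with i hi
    simp [hv_def, hi]
  have hfx : (fun i => f (x i) - f (φ 0) - 1 / 2 * inner ℝ (A (B (u i))) (B (u i))) =o[l]
      fun i => ‖u i‖ ^ 2 := by
    refine (htaylor.comp_tendsto hu).congr' ?_ EventuallyEq.rfl
    filter_upwards [hφu] with i hi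
    simp [hu_def, hi]
  have hgx : (fun i => riemGrad M f (x i) - A (B (u i))) =o[l] u := by
    refine (hgo.comp_tendsto hu).congr' ?_ EventuallyEq.rfl
    filter_upwards [hφu] with i hi
    simp [hu_def, hi]
  have hgη : (fun i => inner ℝ (riemGrad M f (x i)) (η i) + inner ℝ (A (B (u i))) (B (u i))) =o[l]
      fun i => ‖u i‖ ^ 2 := by
    have h1 := (hgx.norm_norm.mul_isBigO hηO.norm_norm).add
      (hABu.norm_norm.mul_isLittleO hηB.norm_norm)
    refine IsBigO.trans_isLittleO ?_ (h1.congr_right fun i => (sq _).symm)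
    refine IsBigO.of_bound 1 (Eventually.of_forall fun i => ?_)
    have h2 : inner ℝ (riemGrad M f (x i)) (η i) + inner ℝ (A (B (u i))) (B (u i)) =
        inner ℝ (riemGrad M f (x i) - A (B (u i))) (η i) +
          inner ℝ (A (B (u i))) (η i + B (u i)) := by
      rw [inner_sub_left, inner_add_right]
      ring
    rw [h2, one_mul]
    exact ((abs_add_le _ _).trans (add_le_add (abs_real_inner_le_norm _ _)
      (abs_real_inner_le_norm _ _))).trans (le_abs_self _)
  -- This is the Armijo defect plus `(1/2 - m₁) q(u)`; an error of at most `(1/2 - m₁) a ‖u‖²` is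
  -- absorbed by coercivity.
  have htotal := (hfy.sub hfx).sub (hgη.const_mul_left m₁)
  filter_upwards [htotal.bound (c := (1 / 2 - m₁) * a) (mul_pos (by linarith) ha)] with i hi
  have h1 := (le_abs_self _).trans hi
  rw [Real.norm_of_nonneg (by positivity)] at h1
  have h2 := mul_le_mul_of_nonneg_left (hq (u i)) (by linarith : 0 ≤ 1 / 2 - m₁)
  rw [ContinuousLinearMap.comp_apply] at h2
  rw [Armijo, one_smul]
  linarith
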